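/- Let $G=(V,E)$ be a finite graph, loops and multiple edges allowed, and let $\mathbb E$ be its set of arrows: each edge (loops included) carries two arrows $a,\bar a$, reverse to each other; $\mathbb E_v$ is the set of arrows with tail $v$. Let $\mathbf k$ be a field and $\Upsilon=\mathbf k^{\mathbb E}=\bigoplus_{v\in V}\mathbf k^{\mathbb E_v}$; for $I\subseteq V$ let $\mathrm{proj}_I\colon\Upsilon\to\bigoplus_{v\in I}\mathbf k^{\mathbb E_v}$ be the projection. For an ordered partition $\pi=(\pi_1,\dots,\pi_r)$ of $V$ into nonempty parts, with level function $h\colon V\to\{1,\dots,r\}$, an arrow from $u$ to $v$ is upward if $h(u)>h(v)$, downward if $h(u)<h(v)$, and horizontal if $h(u)=h(v)$. The residue space $\mathcal G_\pi\subseteq\Upsilon$ consists of the $\psi$ such that - $\psi_a=0$ for every downward arrow $a$; - $\sum_{a\in\mathbb E_v}\psi_a=0$ for every $v\in V$; - $\psi_a+\psi_{\bar a}=0$ for every horizontal arrow $a$; - $\sum_a\psi_a=0$, the sum being over the (upward) arrows $a$ with tail of level $n$ and head in $\Xi$, for every $n\in\{1,\dots,r\}$ and every connected component $\Xi$ of the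 subgraph of $G$ induced on $\{v : h(v)<n\}$. Let $\gamma_\pi(I)=\dim_{\mathbf k}\mathrm{proj}_I(\mathcal G_\pi)$ for $I\subseteq V$. Put $F_0=\emptyset$ and $F_n=\pi_1\cup\dots\cup\pi_n$. For a subspace $W\subseteq\Upsilon$ let $W^{I}=\{w\in W : \mathrm{proj}_{V\setminus I}(w)=0\}$ and $W(\pi)=\bigoplus_{n=1}^r\mathrm{proj}_{\pi_n}(W^{F_n})\subseteq\Upsilon$. For $\eta\colon 2^V\to\mathbb Z$ with $\eta(\emptyset)=0$ let $\eta^*(I)=\eta(V)-\eta(V\setminus I)$. The splitting with respect to $\pi$ of a supermodular function $\mu$ is $\mu_\pi(I)=\sum_{n=1}^r\bigl(\mu((I\cap F_n)\cup F_{n-1})-\mu(F_{n-1})\bigr)$, and that of a submodular function $\eta$ is the adjoint $((\eta^*)_\pi)^*$ of the splitting of its adjoint. Let $\pi'$ be a coarsening of $\pi$, that is, an ordered partition of $V$ whose level function is $c\circ h$ for a nondecreasing map $c$. Let $d\colon V\to\mathbb Z$ be a function inducing $\pi$: it takes a constant value $d_n$ on each $\pi_n$, and $d_1<\dots<d_r$.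 Let $x=(t^{-d_v})_{v\in V}$ act on $\Upsilon\otimes_{\mathbf k}\mathbf k[t,t^{-1}]$ by $(x\cdot\varphi)_a=t^{-d_v}\varphi_a$ for $a\in\mathbb E_v$, and let $m=\dim_{\mathbf k}\mathcal G_{\pi'}$. Then $$\lim_{t\to0}x\cdot\mathcal G_{\pi'}=\mathcal G_\pi$$ in the Grassmannian $\mathrm{Grass}(m,\Upsilon)$; that is, the morphism $\mathbb A^1\setminus\{0\}\to\mathrm{Grass}(m,\Upsilon)$ given by $x\cdot(\mathcal G_{\pi'}\otimes_{\mathbf k}\mathbf k[t,t^{-1}])$ extends to $\mathbb A^1$ with value $\mathcal G_\pi$ at $t=0$. Moreover, $\mathcal G_\pi=\mathcal G_{\pi'}(\pi)$, the submodular function $\gamma_\pi$ is the splitting of $\gamma_{\pi'}$ with respect to $\pi$, and $\gamma_\pi(I)\le\gamma_{\pi'}(I)$ for all $I\subseteq V$. -/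

import Mathlib

open scoped Polynomial LaurentPolynomial

noncomputable section

/-- A graph with vertex set `V`, possibly with loops and parallel edges, given by its arrows.
An edge is a pair `{a, rev a}` of mutually reverse arrows; in particular every edge, loops
included, carries exactly two arrows. The graph is finite when `V` and `A` are. -/
structure Multigraph (V A : Type*) where
  tail : A → V
  rev : A → A
  rev_rev : ∀ a, rev (rev a) = a
  rev_ne : ∀ a, rev a ≠ a

namespace Multigraph

variable {V A : Type*} (G : Multigraph V A)

/-- The head of an arrow. -/
def head (a : A) : V := G.tail (G.rev a)

/-- The simple graph obtained by forgetting loops and multiplicities. Its induced subgraphs have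
the same connected components as the induced subgraphs of `G`. -/
def toSimpleGraph : SimpleGraph V :=
  SimpleGraph.fromRel fun u v => ∃ a, G.tail a = u ∧ G.head a = v

end Multigraph

/-- An ordered partition `π = (π_1, …, π_r)` of `V` into nonempty parts, encoded by its level
function, a surjection onto an `r`-element chain. -/
structure OrdPartition (V : Type*) where
  length : ℕ
  level : V → Fin length
  level_surjective : Function.Surjective level

namespace OrdPartition

variable {V : Type*}

/-- The `n`-th part `π_n`. -/
def part (π : OrdPartition V) (n : Fin π.length) : Set V := {v | π.level v = n}

/-- The set `V_{h ≤ n}`, that is, the step `F_n` of the filtration of `V`. -/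
def below (π : OrdPartition V) (n : Fin π.length) : Set V := {v | π.level v ≤ n}

/-- The set `V_{h < n}`, that is, the step `F_{n-1}` of the filtration of `V`. -/
def strictlyBelow (π : OrdPartition V) (n : Fin π.length) : Set V := {v | π.level v < n}

/-- `π'` is a coarsening of `π`. -/
def IsCoarsening (π' π : OrdPartition V) : Prop :=
  ∃ c : Fin π.length → Fin π'.length, Monotone c ∧ π'.level = c ∘ π.level

/-- The parts of `π` are the level sets of `d`, listed by increasing values of `d`. -/
def IsInducedBy (π : OrdPartition V) (d : V → ℤ) : Prop :=
  ∃ e : Fin π.length → ℤ, StrictMono e ∧ d = e ∘ π.level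

end OrdPartition

namespace Multigraph

variable {V A : Type*} (G : Multigraph V A) (π : OrdPartition V)

/-- Upward arrows: the level drops from tail to head. -/
def IsUpward (a : A) : Prop := π.level (G.head a) < π.level (G.tail a)

/-- Downward arrows: the level grows from tail to head. -/
def IsDownward (a : A) : Prop := π.level (G.tail a) < π.level (G.head a)

/-- Horizontal arrows. -/
def IsHorizontal (a : A) : Prop := π.level (G.tail a) = π.level (G.head a)

open scoped Classical in
/-- The `π`-residue space, a subspace of `k^A`. -/
def residueSpace [Fintype A] (k : Type*) [Field k] : Submodule k (A → k) where
  carrier := {ψ |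
    (∀ a, G.IsDownward π a → ψ a = 0) ∧
    (∀ v, ∑ a with G.tail a = v, ψ a = 0) ∧
    (∀ a, G.IsHorizontal π a → ψ a + ψ (G.rev a) = 0) ∧
    (∀ (n : Fin π.length)
      (Ξ : (G.toSimpleGraph.induce (π.strictlyBelow n)).ConnectedComponent),
      ∑ a with G.IsUpward π a ∧ π.level (G.tail a) = n ∧ G.head a ∈ Subtype.val '' Ξ.supp,
        ψ a = 0)}
  zero_mem' := by simp
  add_mem' := by
    rintro φ ψ ⟨h1, h2, h3, h4⟩ ⟨h1', h2', h3', h4'⟩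
    refine ⟨fun a ha => ?_, fun v => ?_, fun a ha => ?_, fun n Ξ => ?_⟩
    · simp [h1 a ha, h1' a ha]
    · simp only [Pi.add_apply, Finset.sum_add_distrib, h2 v, h2' v, add_zero]
    · simp only [Pi.add_apply]
      linear_combination h3 a ha + h3' a ha
    · simp only [Pi.add_apply, Finset.sum_add_distrib, h4 n Ξ, h4' n Ξ, add_zero]
  smul_mem' := by
    rintro c ψ ⟨h1, h2, h3, h4⟩
    refine ⟨fun a ha => ?_, fun v => ?_, fun a ha => ?_, fun n Ξ => ?_⟩
    · simp [h1 a ha]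
    · simp only [Pi.smul_apply, ← Finset.smul_sum, h2 v, smul_zero]
    · simp only [Pi.smul_apply, ← smul_add, h3 a ha, smul_zero]
    · simp only [Pi.smul_apply, ← Finset.smul_sum, h4 n Ξ, smul_zero]

end Multigraph

/-! ### Subspaces of `k^A = ⨁ v, k^{A_v}`

A map `τ : A → V` decomposes `k^A` as the direct sum over `v` of the spaces `k^{A_v}`, where `A_v`
is the fibre of `τ` over `v`. For a graph, `τ` is the tail map. -/

section Subspaces

variable {V A k : Type*} [Field k] (τ : A → V)

/-- The projection `k^A → k^{A_I}` with `A_I = τ⁻¹(I)`. -/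
def projOn (k : Type*) [Field k] (I : Set V) : (A → k) →ₗ[k] ({a // τ a ∈ I} → k) :=
  LinearMap.funLeft k k Subtype.val

/-- The inclusion `k^{A_I} → k^A`, extension by zero. -/
def inclOn (k : Type*) [Field k] (I : Set V) : ({a // τ a ∈ I} → k) →ₗ[k] (A → k) :=
  Function.ExtendByZero.linearMap k Subtype.val

/-- `W^I`, the kernel of the projection of `W` on the complement of `I`. -/
def vanishingOff (W : Submodule k (A → k)) (I : Set V) : Submodule k (A → k) :=
  W ⊓ LinearMap.ker (projOn τ k Iᶜ)

/-- The submodular function of `W`, with value `dim proj_I(W)` at `I`. -/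
def dimFun (W : Submodule k (A → k)) (I : Set V) : ℤ :=
  Module.finrank k (W.map (projOn τ k I))

/-- `W(π) = ⨁ n, proj_{π_n}(W^{F_n})`, as a subspace of `k^A`. -/
def splitSubspace (W : Submodule k (A → k)) (π : OrdPartition V) : Submodule k (A → k) :=
  ⨆ n : Fin π.length,
    ((vanishingOff τ W (π.below n)).map (projOn τ k (π.part n))).map (inclOn τ k (π.part n))

end Subspaces

/-! ### Splittings of set functions -/

section SetFunctions

variable {V : Type*}

/-- The adjoint `η^*` of a set function. It exchanges submodular and supermodular functions. -/
def adjointFun (η : Set V → ℤ) (I : Set V) : ℤ := η Set.univ - η Iᶜ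

/-- The splitting `μ_π` of a supermodular function `μ`. -/
def superSplitting (π : OrdPartition V) (μ : Set V → ℤ) (I : Set V) : ℤ :=
  ∑ n : Fin π.length,
    (μ ((I ∩ π.below n) ∪ π.strictlyBelow n) - μ (π.strictlyBelow n))

/-- The splitting of a submodular function `η`: the submodular function adjoint to the splitting
of the supermodular function `η^*`. -/
def subSplitting (π : OrdPartition V) (η : Set V → ℤ) : Set V → ℤ :=
  adjointFun (superSplitting π (adjointFun η))

end SetFunctions

/-- The function `γ_π` of the level graph `(G, π)`. -/
def Multigraph.gammaFun {V A : Type*} [Fintype A] (G : Multigraph V A) (π : OrdPartition V)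
    (k : Type*) [Field k] : Set V → ℤ :=
  dimFun G.tail (G.residueSpace π k)

/-! ### Limits in the Grassmannian -/

section Limits

variable {V A : Type*}

/-- Base change of a submodule `M` of `S^A` along `f : S → T`: the image of `T ⊗ M` in `T^A`. -/
def extendScalarsAlong {S T : Type*} [CommRing S] [CommRing T] (f : S →+* T)
    (M : Submodule S (A → S)) : Submodule T (A → T) :=
  Submodule.span T ((fun φ a => f (φ a)) '' (M : Set (A → S)))

/-- The componentwise action of `x ∈ (Sˣ)^V` on `S^A = ⨁ v, S^{A_v}`. -/
def torusAct {S : Type*} [CommRing S] (τ : A → V) (x : V → Sˣ) : (A → S) →ₗ[S] (A → S) :=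
  LinearMap.pi fun a => (x (τ a) : S) • LinearMap.proj a

/-- The power `t ^ n` as a unit of `k[t, t⁻¹]`. -/
def tPow (k : Type*) [Field k] (n : ℤ) : (k[T;T⁻¹])ˣ where
  val := LaurentPolynomial.T n
  inv := LaurentPolynomial.T (-n)
  val_inv := by rw [← LaurentPolynomial.T_add]; simp
  inv_val := by rw [← LaurentPolynomial.T_add]; simp

/-- For `N` a submodule of `k[t, t⁻¹]^A` of rank `m` (a family of `m`-dimensional subspaces of
`k^A` over the punctured line), `L` is the limit of `N` as `t → 0` in the Grassmannian of
`m`-dimensional subspaces: there is a morphism from the affine line to the Grassmannian which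
restricts to `N` over `t ≠ 0` and takes the value `L` at `t = 0`. Such a morphism is a submodule
of `k[t]^A` with locally free quotient of rank `|A| - m`; Mathlib's Grassmannians are indexed
by the rank of the quotient. -/
def IsLimitAtZero [Fintype A] {k : Type*} [Field k] (m : ℕ)
    (N : Submodule k[T;T⁻¹] (A → k[T;T⁻¹])) (L : Submodule k (A → k)) : Prop :=
  ∃ M : Module.Grassmannian k[X] (A → k[X]) (Fintype.card A - m),
    extendScalarsAlong Polynomial.toLaurent M.toSubmodule = N ∧
    extendScalarsAlong (Polynomial.evalRingHom 0) M.toSubmodule = L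

/-- Limits in the Grassmannian are unique. -/
theorem IsLimitAtZero.unique [Fintype A] {k : Type*} [Field k] {m : ℕ}
    {N : Submodule k[T;T⁻¹] (A → k[T;T⁻¹])} {L L' : Submodule k (A → k)}
    (h : IsLimitAtZero m N L) (h' : IsLimitAtZero m N L') : L = L' := by
  have key : ∀ M M' : Module.Grassmannian k[X] (A → k[X]) (Fintype.card A - m),
      extendScalarsAlong Polynomial.toLaurent M.toSubmodule =
        extendScalarsAlong Polynomial.toLaurent M'.toSubmodule →
      M.toSubmodule ≤ M'.toSubmodule := by
    intro M M' hM f hf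
    have h1 : (fun a => Polynomial.toLaurent (f a)) ∈
        extendScalarsAlong Polynomial.toLaurent M'.toSubmodule := by
      rw [← hM]
      exact Submodule.subset_span ⟨f, hf, rfl⟩
    have h2 : ∀ g ∈ extendScalarsAlong Polynomial.toLaurent M'.toSubmodule,
        ∃ n : ℕ, ∃ p ∈ M'.toSubmodule,
          ∀ a, Polynomial.toLaurent (p a) = g a * LaurentPolynomial.T n := by
      intro g hg
      induction hg using Submodule.span_induction with
      | mem x hx =>
        obtain ⟨p, hp, rfl⟩ := hx
        exact ⟨0, p, hp, fun a => by simp⟩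
      | zero => exact ⟨0, 0, Submodule.zero_mem _, fun a => by simp⟩
      | add x y _ _ hx hy =>
        obtain ⟨n, p, hp, e⟩ := hx
        obtain ⟨n', p', hp', e'⟩ := hy
        refine ⟨n + n', (Polynomial.X ^ n' : k[X]) • p + (Polynomial.X ^ n : k[X]) • p',
          Submodule.add_mem _ (Submodule.smul_mem _ _ hp) (Submodule.smul_mem _ _ hp'),
          fun a => ?_⟩
        simp only [Pi.add_apply, Pi.smul_apply, smul_eq_mul, map_add, map_mul, e, e',
          Polynomial.toLaurent_X_pow, Nat.cast_add, LaurentPolynomial.T_add]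
        ring
      | smul r x _ hx =>
        obtain ⟨n, p, hp, e⟩ := hx
        obtain ⟨n', r', hr⟩ := LaurentPolynomial.exists_T_pow r
        refine ⟨n + n', r' • p, Submodule.smul_mem _ _ hp, fun a => ?_⟩
        simp only [Pi.smul_apply, smul_eq_mul, map_mul, e, hr, Nat.cast_add,
          LaurentPolynomial.T_add]
        ring
    obtain ⟨n, p, hp, e⟩ := h2 _ h1
    have h3 : p = (Polynomial.X ^ n : k[X]) • f := by
      funext a
      apply Polynomial.toLaurent_injective
      rw [e a]
      simp only [Pi.smul_apply, smul_eq_mul, map_mul, Polynomial.toLaurent_X_pow]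
      exact mul_comm _ _
    have h4 : (Polynomial.X ^ n : k[X]) • M'.toSubmodule.mkQ f = 0 := by
      rw [← map_smul, ← h3]
      simpa using hp
    rcases smul_eq_zero.1 h4 with h5 | h5
    · exact absurd h5 (pow_ne_zero _ Polynomial.X_ne_zero)
    · simpa using h5
  obtain ⟨M, hM, rfl⟩ := h
  obtain ⟨M', hM', rfl⟩ := h'
  rw [le_antisymm (key M M' (hM.trans hM'.symm)) (key M' M (hM'.trans hM.symm))]

end Limits

end

/-! Two independent facts give the theorem. The first is linear algebra: for every subspace
$W\subseteq\Upsilon$, the limit of $x\cdot W$ is $W(\pi)$. Choosing for each $n$ a linear lift of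
$\mathrm{proj}_{\pi_n}(W^{F_n})$ to $W^{F_n}$ produces a matrix $g$ with $g\,W(\pi)=W$ that is the
identity plus terms strictly lowering the level (`exists_isStrictlyLowering_map_splitSubspace`).
Since $W(\pi)$ is a sum of pieces supported on single levels, it is stable under $x$, so $x\cdot
W=(xgx^{-1})\,W(\pi)$. The entries of $P=xgx^{-1}$ are $t^{d_b-d_a}g_{ab}$: they are polynomial,
$\det P=1$, and $P$ is the identity at $t=0$. Hence $P$ applied to the constant family $W(\pi)$ is
the extension over $\mathbb A^1$ (`isLimitAtZero_splitSubspace`). The splitting formula for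
dimensions is rank-nullity level by level, and the inequality follows from $\dim W(\pi)=\dim W$
applied to projections of $W$.

The second fact is $\mathcal G_\pi=\mathcal G_{\pi'}(\pi)$, proved by two inclusions. The conditions
on sums are first rewritten as orthogonality to functions on vertices (`mem_residueSpace_iff`). For
$\supseteq$, the residue condition for $\pi$ comes from that for $\pi'$ by discrete integration by
parts, cancelling each arrow against its reverse. For $\subseteq$, the part of $\psi$ on level $n$
must be extended to lower levels: the residue conditions at level $n$ are exactly the solvability
conditions for a flow on $\{h<n\}$ absorbing what level $n$ sends down (`exists_flow`). -/

noncomputable section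

/-! ### Coordinate restrictions and membership in $W(\pi)$. -/

section CoordinateProjections

variable {V A k : Type*} [Field k] (τ : A → V)

open scoped Classical in
theorem inclOn_projOn_apply (I : Set V) (φ : A → k) (a : A) :
    inclOn τ k I (projOn τ k I φ) a = if τ a ∈ I then φ a else 0 := by
  split_ifs with h
  · exact Subtype.val_injective.extend_apply (projOn τ k I φ) 0 ⟨a, h⟩
  · refine Function.extend_apply' (projOn τ k I φ) (0 : A → k) a ?_
    rintro ⟨b, rfl⟩
    exact h b.2

theorem inclOn_injective (I : Set V) : Function.Injective (inclOn τ k I) := by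
  intro x y h
  funext b
  have := congrFun h b.1
  rwa [inclOn, Function.ExtendByZero.linearMap_apply, Function.ExtendByZero.linearMap_apply,
    Subtype.val_injective.extend_apply, Subtype.val_injective.extend_apply] at this

theorem mem_ker_projOn {I : Set V} {φ : A → k} :
    φ ∈ LinearMap.ker (projOn τ k I) ↔ ∀ a, τ a ∈ I → φ a = 0 := by
  rw [LinearMap.mem_ker]
  constructor
  · intro h a ha
    exact congrFun h ⟨a, ha⟩
  · intro h
    funext b
    exact h b.1 b.2

theorem mem_vanishingOff {W : Submodule k (A → k)} {I : Set V} {φ : A → k} :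
    φ ∈ vanishingOff τ W I ↔ φ ∈ W ∧ ∀ a, τ a ∉ I → φ a = 0 := by
  rw [vanishingOff, Submodule.mem_inf, mem_ker_projOn]
  rfl

/-- The endomorphism of `k^A` which keeps the coordinates over `I` and kills the others. -/
def restrictTo (k : Type*) [Field k] (I : Set V) : (A → k) →ₗ[k] (A → k) :=
  inclOn τ k I ∘ₗ projOn τ k I

open scoped Classical in
theorem restrictTo_apply (I : Set V) (φ : A → k) (a : A) :
    restrictTo τ k I φ a = if τ a ∈ I then φ a else 0 :=
  inclOn_projOn_apply τ I φ a

theorem restrictTo_apply_of_mem {I : Set V} (φ : A → k) {a : A} (h : τ a ∈ I) :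
    restrictTo τ k I φ a = φ a := by
  rw [restrictTo_apply, if_pos h]

theorem restrictTo_apply_of_notMem {I : Set V} (φ : A → k) {a : A} (h : τ a ∉ I) :
    restrictTo τ k I φ a = 0 := by
  rw [restrictTo_apply, if_neg h]

theorem dimFun_eq_finrank_restrictTo (W : Submodule k (A → k)) (I : Set V) :
    dimFun τ W I = Module.finrank k (W.map (restrictTo τ k I)) := by
  rw [dimFun, restrictTo, Submodule.map_comp]
  exact_mod_cast
    (LinearEquiv.finrank_eq (Submodule.equivMapOfInjective _ (inclOn_injective τ I) _))

theorem splitSubspace_eq_iSup (W : Submodule k (A → k)) (π : OrdPartition V) :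
    splitSubspace τ W π =
      ⨆ n, (vanishingOff τ W (π.below n)).map (restrictTo τ k (π.part n)) := by
  simp only [splitSubspace, restrictTo, Submodule.map_comp]

theorem mem_map_vanishingOff_below {W : Submodule k (A → k)} {π : OrdPartition V}
    {n : Fin π.length} {φ : A → k} :
    φ ∈ (vanishingOff τ W (π.below n)).map (restrictTo τ k (π.part n)) ↔
      (∀ a, π.level (τ a) ≠ n → φ a = 0) ∧
      ∃ w ∈ W, (∀ a, n < π.level (τ a) → w a = 0) ∧ ∀ a, π.level (τ a) = n → w a = φ a := by
  rw [Submodule.mem_map]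
  constructor
  · rintro ⟨w, hw, rfl⟩
    rw [mem_vanishingOff] at hw
    exact ⟨fun a ha => restrictTo_apply_of_notMem τ w ha, w, hw.1,
      fun a ha => hw.2 a (not_le.2 ha), fun a ha => (restrictTo_apply_of_mem τ w ha).symm⟩
  · rintro ⟨h0, w, hw, h1, h2⟩
    refine ⟨w, (mem_vanishingOff τ).2 ⟨hw, fun a ha => h1 a (not_le.1 ha)⟩, ?_⟩
    funext a
    by_cases ha : π.level (τ a) = n
    · rw [restrictTo_apply_of_mem τ w ha, h2 a ha]
    · rw [restrictTo_apply_of_notMem τ w ha, h0 a ha]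

/-- A family of elements supported on the single parts of `π` is determined by its sum. -/
theorem sum_apply_of_supported {π : OrdPartition V} (f : Fin π.length → A → k)
    (hf : ∀ n a, π.level (τ a) ≠ n → f n a = 0) (a : A) :
    (∑ n, f n) a = f (π.level (τ a)) a := by
  rw [Finset.sum_apply]
  exact Finset.sum_eq_single_of_mem _ (Finset.mem_univ _) fun n _ hn => hf n a hn.symm

/-- The levels are independent of each other: the witness `w` may change with `n`. All later
arguments about $W(\pi)$ can use this form instead of the supremum. -/
theorem mem_splitSubspace {W : Submodule k (A → k)} {π : OrdPartition V} {φ : A → k} :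
    φ ∈ splitSubspace τ W π ↔
      ∀ n, ∃ w ∈ W, (∀ a, n < π.level (τ a) → w a = 0) ∧
        ∀ a, π.level (τ a) = n → w a = φ a := by
  rw [splitSubspace_eq_iSup]
  constructor
  · intro h n
    rw [Submodule.mem_iSup_iff_exists_finsupp] at h
    obtain ⟨f, hf, rfl⟩ := h
    obtain ⟨h0, w, hw, h1, h2⟩ := (mem_map_vanishingOff_below τ).1 (hf n)
    refine ⟨w, hw, h1, fun a ha => ?_⟩
    rw [Finsupp.sum_fintype _ _ fun _ => rfl, sum_apply_of_supported τ, ha, h2 a ha]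
    exact fun m b hb => ((mem_map_vanishingOff_below τ).1 (hf m)).1 b hb
  · intro h
    have e : φ = ∑ n, restrictTo τ k (π.part n) φ := by
      funext a
      rw [sum_apply_of_supported τ]
      · exact (restrictTo_apply_of_mem τ φ (I := π.part _) (a := a) rfl).symm
      exact fun n b hb => restrictTo_apply_of_notMem τ φ hb
    rw [e]
    refine Submodule.sum_mem _ fun n _ => Submodule.mem_iSup_of_mem n ?_
    obtain ⟨w, hw, h1, h2⟩ := h n
    refine (mem_map_vanishingOff_below τ).2
      ⟨fun a ha => restrictTo_apply_of_notMem τ φ ha, w, hw, h1, fun a ha => ?_⟩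
    rw [h2 a ha, restrictTo_apply_of_mem τ φ ha]

/-- The dimension of the span of subspaces supported on the single parts of `π`. -/
theorem finrank_iSup_of_supported [Finite A] {π : OrdPartition V}
    (U : Fin π.length → Submodule k (A → k))
    (hU : ∀ n, ∀ φ ∈ U n, ∀ a, π.level (τ a) ≠ n → φ a = 0) :
    Module.finrank k ↥(⨆ n, U n) = ∑ n, Module.finrank k (U n) := by
  let Φ : (∀ n, U n) →ₗ[k] (A → k) := ∑ n, (U n).subtype ∘ₗ LinearMap.proj n
  have hΦ : ∀ f a, Φ f a = (f (π.level (τ a)) : A → k) a := by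
    intro f a
    rw [← sum_apply_of_supported τ (fun n => (f n : A → k)) fun n b hb => hU n _ (f n).2 b hb]
    simp [Φ]
  have hinj : Function.Injective Φ := by
    intro f g h
    funext n
    ext a
    by_cases ha : π.level (τ a) = n
    · have := congrFun h a
      rw [hΦ, hΦ] at this
      subst ha
      exact this
    · rw [hU n _ (f n).2 a ha, hU n _ (g n).2 a ha]
  have hrange : LinearMap.range Φ = ⨆ n, U n := by
    apply le_antisymm
    · rintro _ ⟨f, rfl⟩
      simp only [Φ, LinearMap.sum_apply, LinearMap.comp_apply, LinearMap.proj_apply,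
        Submodule.subtype_apply]
      exact Submodule.sum_mem _ fun n _ => Submodule.mem_iSup_of_mem n (f n).2
    · refine iSup_le fun n φ hφ => ?_
      classical
      refine ⟨Pi.single n ⟨φ, hφ⟩, ?_⟩
      funext a
      rw [hΦ]
      by_cases ha : π.level (τ a) = n
      · subst ha
        simp
      · rw [Pi.single_eq_of_ne ha, hU n φ hφ a ha]
        rfl
  rw [← hrange, LinearMap.finrank_range_of_inj hinj, Module.finrank_pi_fintype]

end CoordinateProjections

/-! ### A unipotent matrix carrying $W(\pi)$ onto $W$. -/

section Unipotent

variable {V A k : Type*} [Field k] (τ : A → V)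

/-- A linear section over the image of a subspace. -/
theorem exists_linearMap_section {E F : Type*} [AddCommGroup E] [Module k E] [AddCommGroup F]
    [Module k F] (p : E →ₗ[k] F) (W : Submodule k E) :
    ∃ e : F →ₗ[k] E, ∀ u ∈ W.map p, e u ∈ W ∧ p (e u) = u := by
  obtain ⟨s, hs⟩ := LinearMap.exists_rightInverse_of_surjective
    ((p.domRestrict W).rangeRestrict) (LinearMap.range_rangeRestrict _)
  obtain ⟨e, he⟩ := LinearMap.exists_extend (W.subtype ∘ₗ s)
  refine ⟨e, fun u hu => ?_⟩
  have hu' : u ∈ LinearMap.range (p.domRestrict W) := by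
    obtain ⟨w, hw, rfl⟩ := hu
    exact ⟨⟨w, hw⟩, rfl⟩
  have h1 : e u = s ⟨u, hu'⟩ := LinearMap.congr_fun he ⟨u, hu'⟩
  rw [h1]
  refine ⟨(s ⟨u, hu'⟩).2, ?_⟩
  exact congrArg Subtype.val (LinearMap.congr_fun hs ⟨u, hu'⟩)

variable [Fintype A] [DecidableEq A]

/-- A matrix that is unipotent and lowers strictly a level function off the diagonal. -/
def IsStrictlyLowering {R ι : Type*} [CommRing R] [LT ι] (h : A → ι) (g : Matrix A A R) : Prop :=
  (∀ a, g a a = 1) ∧ ∀ a b, a ≠ b → ¬ h a < h b → g a b = 0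

/-- The matrix is block triangular for the level function, and each diagonal block is an identity
matrix. -/
theorem IsStrictlyLowering.det_eq_one {R ι : Type*} [CommRing R] [LinearOrder ι] [Fintype ι]
    {h : A → ι} {g : Matrix A A R} (hg : IsStrictlyLowering h g) : g.det = 1 := by
  have ht : g.BlockTriangular h := by
    intro a b hab
    exact hg.2 a b (fun e => hab.ne (by rw [e])) hab.not_gt
  rw [ht.det_fintype]
  refine Finset.prod_eq_one fun i _ => ?_
  have : g.toSquareBlock h i = 1 := by
    ext a b
    rw [Matrix.toSquareBlock_def, Matrix.of_apply, Matrix.one_apply]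
    split_ifs with e
    · rw [e, hg.1]
    · exact hg.2 _ _ (fun e' => e (Subtype.ext e')) (by rw [a.2, b.2]; exact lt_irrefl i)
  rw [this, Matrix.det_one]

/-- An element of $W^{F_n}$ has its leading part on level $n$, and $W(\pi)$ collects the leading
parts. The matrix restores the lower terms, as in Gaussian elimination. -/
theorem exists_isStrictlyLowering_map_splitSubspace (W : Submodule k (A → k))
    (π : OrdPartition V) :
    ∃ g : Matrix A A k, IsStrictlyLowering (fun a => π.level (τ a)) g ∧
      (splitSubspace τ W π).map g.mulVecLin = W := by
  choose e he using fun n => exists_linearMap_section (restrictTo τ k (π.part n))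
    (vanishingOff τ W (π.below n))
  -- For `b` on level `n`, column `b` is the basis vector plus the part of `e n (Pi.single b 1)`
  -- strictly below `n`. That lift need not lie in `W`; only on actual leading parts `u` does `g`
  -- agree with `e n`.
  let g : Matrix A A k := Matrix.of fun a b =>
    if a = b then 1
    else if π.level (τ a) < π.level (τ b) then e (π.level (τ b)) (Pi.single b 1) a else 0
  have hg : ∀ n, ∀ u ∈ (vanishingOff τ W (π.below n)).map (restrictTo τ k (π.part n)),
      g.mulVec u = e n u := by
    intro n u hu
    obtain ⟨h1, h2⟩ := he n u hu
    have h0 := ((mem_map_vanishingOff_below τ).1 hu).1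
    rw [mem_vanishingOff] at h1
    funext a
    have key : e n u a = ∑ b, e n (Pi.single b 1) a * u b := by
      conv_lhs => rw [LinearMap.pi_apply_eq_sum_univ (e n) u]
      rw [Finset.sum_apply]
      refine Finset.sum_congr rfl fun b _ => ?_
      rw [Pi.smul_apply, smul_eq_mul, mul_comm]
      have : (fun c => if b = c then (1 : k) else 0) = Pi.single b 1 := by
        funext c
        simp [Pi.single_apply, eq_comm]
      rw [this]
    rw [Matrix.mulVec, dotProduct]
    rcases lt_trichotomy (π.level (τ a)) n with hlt | heq | hgt
    · rw [key]
      refine Finset.sum_congr rfl fun b _ => ?_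
      by_cases hb : π.level (τ b) = n
      · have : a ≠ b := by rintro rfl; exact hlt.ne hb
        simp only [g, Matrix.of_apply, if_neg this, hb, if_pos hlt]
      · rw [h0 b hb, mul_zero, mul_zero]
    · rw [Finset.sum_eq_single_of_mem a (Finset.mem_univ _)]
      · have := congrFun h2 a
        rw [restrictTo_apply_of_mem τ _ heq] at this
        simp [g, this]
      · intro b _ hb
        by_cases hb' : π.level (τ b) = n
        · simp [g, hb.symm, heq, hb']
        · rw [h0 b hb', mul_zero]
    · rw [h1.2 a (not_le.2 hgt)]
      refine Finset.sum_eq_zero fun b _ => ?_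
      by_cases hb : π.level (τ b) = n
      · have : a ≠ b := by rintro rfl; exact hgt.ne' hb
        simp only [g, Matrix.of_apply, if_neg this, hb, if_neg hgt.not_gt, zero_mul]
      · rw [h0 b hb, mul_zero]
  refine ⟨g, ⟨fun a => by simp [g], fun a b hab h => ?_⟩, le_antisymm ?_ ?_⟩
  · simp only [g, Matrix.of_apply, if_neg hab, if_neg h]
  · rw [splitSubspace_eq_iSup, Submodule.map_iSup]
    refine iSup_le fun n => ?_
    rintro _ ⟨u, hu, rfl⟩
    rw [Matrix.mulVecLin_apply, hg n u hu]
    exact ((mem_vanishingOff τ).1 (he n u hu).1).1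
  · have key : ∀ N : ℕ, ∀ w ∈ W, (∀ a, N ≤ (π.level (τ a) : ℕ) → w a = 0) →
        w ∈ (splitSubspace τ W π).map g.mulVecLin := by
      intro N
      induction N with
      | zero =>
        intro w _ h
        have : w = 0 := funext fun a => h a (Nat.zero_le _)
        rw [this]
        exact Submodule.zero_mem _
      | succ N ih =>
        intro w hw h
        by_cases hN : N < π.length
        · let n : Fin π.length := ⟨N, hN⟩
          have hwn : w ∈ vanishingOff τ W (π.below n) :=
            (mem_vanishingOff τ).2 ⟨hw, fun a ha => h a (Fin.lt_def.1 (not_le.1 ha))⟩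
          have hu := Submodule.mem_map_of_mem (f := restrictTo τ k (π.part n)) hwn
          obtain ⟨h1, h2⟩ := he n _ hu
          rw [mem_vanishingOff] at h1
          set u := restrictTo τ k (π.part n) w with hudef
          rw [← sub_add_cancel w (e n u)]
          refine Submodule.add_mem _ (ih _ (Submodule.sub_mem _ hw h1.1) fun a ha => ?_) ?_
          · rcases ha.eq_or_lt with ha | ha
            · have ha' : τ a ∈ π.part n := Fin.ext ha.symm
              have := congrFun h2 a
              rw [restrictTo_apply_of_mem τ _ ha', hudef, restrictTo_apply_of_mem τ _ ha'] at this
              rw [Pi.sub_apply, this, sub_self]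
            · rw [Pi.sub_apply, h a ha, h1.2 a (not_le.2 (Fin.lt_def.2 ha)), sub_self]
          · refine ⟨u, ?_, by rw [Matrix.mulVecLin_apply, hg n u hu]⟩
            rw [splitSubspace_eq_iSup]
            exact Submodule.mem_iSup_of_mem n hu
        · exact ih w hw fun a ha => absurd (lt_of_le_of_lt ha (π.level (τ a)).2) hN
    intro w hw
    exact key π.length w hw fun a ha => absurd (π.level (τ a)).2 (not_lt.2 ha)

theorem IsStrictlyLowering.mulVecLin_injective {R ι : Type*} [CommRing R] [LinearOrder ι]
    [Fintype ι] {h : A → ι} {g : Matrix A A R} (hg : IsStrictlyLowering h g) :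
    Function.Injective g.mulVecLin := by
  refine Matrix.mulVec_injective_of_isUnit ((Matrix.isUnit_iff_isUnit_det g).2 ?_)
  rw [hg.det_eq_one]
  exact isUnit_one

end Unipotent

/-! ### Dimensions of projections and the splitting of set functions. -/

section Dimensions

variable {V A k : Type*} [Field k] (τ : A → V)

theorem splitSubspace_map_restrictTo_le (W : Submodule k (A → k)) (π : OrdPartition V)
    (I : Set V) :
    (splitSubspace τ W π).map (restrictTo τ k I) ≤
      splitSubspace τ (W.map (restrictTo τ k I)) π := by
  rintro _ ⟨φ, hφ, rfl⟩
  rw [mem_splitSubspace]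
  intro n
  obtain ⟨w, hw, h1, h2⟩ := (mem_splitSubspace τ).1 hφ n
  refine ⟨_, Submodule.mem_map_of_mem hw, fun a ha => ?_, fun a ha => ?_⟩
  · rw [restrictTo_apply, h1 a ha, ite_self]
  · rw [restrictTo_apply, restrictTo_apply, h2 a ha]

variable [Fintype A]

theorem finrank_splitSubspace (W : Submodule k (A → k)) (π : OrdPartition V) :
    Module.finrank k (splitSubspace τ W π) = Module.finrank k W := by
  classical
  obtain ⟨g, hg, hW⟩ := exists_isStrictlyLowering_map_splitSubspace τ W π
  conv_rhs => rw [← hW]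
  exact LinearEquiv.finrank_eq (Submodule.equivMapOfInjective _ hg.mulVecLin_injective _)

/-- Restriction to `I` sends $W(\pi)$ into the splitting of the restriction of $W$, and splitting
preserves dimension. -/
theorem dimFun_splitSubspace_le (W : Submodule k (A → k)) (π : OrdPartition V) (I : Set V) :
    dimFun τ (splitSubspace τ W π) I ≤ dimFun τ W I := by
  rw [dimFun_eq_finrank_restrictTo, dimFun_eq_finrank_restrictTo, Nat.cast_le,
    ← finrank_splitSubspace τ (W.map (restrictTo τ k I)) π]
  exact Submodule.finrank_mono (splitSubspace_map_restrictTo_le τ W π I)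

theorem finrank_map_add_finrank_inf_ker {E F : Type*} [AddCommGroup E] [Module k E]
    [FiniteDimensional k E] [AddCommGroup F] [Module k F] (f : E →ₗ[k] F) (W : Submodule k E) :
    Module.finrank k (W.map f) + Module.finrank k ↥(W ⊓ LinearMap.ker f) =
      Module.finrank k W := by
  rw [← LinearMap.finrank_range_add_finrank_ker (f.domRestrict W), LinearMap.range_domRestrict]
  congr 1
  rw [LinearMap.ker_domRestrict, ← Submodule.map_comap_subtype]
  exact (LinearEquiv.finrank_eq
    (Submodule.equivMapOfInjective _ W.injective_subtype _)).symm

theorem adjointFun_dimFun (W : Submodule k (A → k)) (I : Set V) :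
    adjointFun (dimFun τ W) I = Module.finrank k (vanishingOff τ W I) := by
  have h1 := finrank_map_add_finrank_inf_ker (projOn τ k Iᶜ) W
  have h2 := finrank_map_add_finrank_inf_ker (projOn τ k Set.univ) W
  have h3 : W ⊓ LinearMap.ker (projOn τ k Set.univ) = ⊥ := by
    rw [eq_bot_iff]
    rintro φ ⟨-, hφ⟩
    exact funext fun a => (mem_ker_projOn τ).1 hφ a trivial
  rw [h3, finrank_bot] at h2
  rw [adjointFun, dimFun, dimFun, vanishingOff]
  lia

/-- The adjoint of the dimension function is $I\mapsto\dim W^I$, so each summand of the adjoint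
splitting is a difference of two such dimensions. Rank-nullity on $W^{F_n}$ identifies it with the
contribution of level $n$. -/
theorem dimFun_splitSubspace (W : Submodule k (A → k)) (π : OrdPartition V) :
    dimFun τ (splitSubspace τ W π) = subSplitting π (dimFun τ W) := by
  funext I
  rw [dimFun_eq_finrank_restrictTo, splitSubspace_eq_iSup, Submodule.map_iSup,
    finrank_iSup_of_supported τ, subSplitting, adjointFun, superSplitting, superSplitting,
    ← Finset.sum_sub_distrib, Nat.cast_sum]
  · refine Finset.sum_congr rfl fun n _ => ?_
    rw [sub_sub_sub_cancel_right, adjointFun_dimFun, adjointFun_dimFun]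
    have h1 : (Set.univ ∩ π.below n) ∪ π.strictlyBelow n = π.below n := by
      rw [Set.univ_inter]
      exact Set.union_eq_left.2 fun v hv => le_of_lt (a := π.level v) hv
    rw [h1, ← Submodule.map_comp,
      ← finrank_map_add_finrank_inf_ker (restrictTo τ k I ∘ₗ restrictTo τ k (π.part n))
        (vanishingOff τ W (π.below n))]
    -- Within $W^{F_n}$, being killed by restriction to $I\cap\pi_n$ means having support over
    -- $(I^c\cap F_n)\cup F_{n-1}$.
    have h2 : vanishingOff τ W (π.below n) ⊓
        LinearMap.ker (restrictTo τ k I ∘ₗ restrictTo τ k (π.part n)) =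
        vanishingOff τ W ((Iᶜ ∩ π.below n) ∪ π.strictlyBelow n) := by
      ext φ
      have hker : φ ∈ LinearMap.ker (restrictTo τ k I ∘ₗ restrictTo τ k (π.part n)) ↔
          ∀ a, τ a ∈ I → π.level (τ a) = n → φ a = 0 := by
        rw [LinearMap.mem_ker, LinearMap.comp_apply, funext_iff]
        refine forall_congr' fun a => ?_
        rw [restrictTo_apply, restrictTo_apply]
        by_cases h : τ a ∈ I <;> by_cases h' : π.level (τ a) = n <;>
          simp [h, h', OrdPartition.part]
      rw [Submodule.mem_inf, hker, mem_vanishingOff, mem_vanishingOff, and_assoc]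
      refine and_congr_right fun _ => ?_
      rw [← forall_and]
      refine forall_congr' fun a => ?_
      simp only [OrdPartition.below, OrdPartition.strictlyBelow, Set.mem_union, Set.mem_inter_iff,
        Set.mem_compl_iff, Set.mem_ofPred_eq]
      have := lt_trichotomy (π.level (τ a)) n
      grind
    rw [h2]
    lia
  · rintro n _ ⟨φ, hφ, rfl⟩ a ha
    rw [restrictTo_apply, ((mem_map_vanishingOff_below τ).1 hφ).1 a ha, ite_self]

end Dimensions

/-! ### Base change of spans. -/

section BaseChange

variable {A S T : Type*} [CommRing S] [CommRing T]

theorem extendScalarsAlong_span (f : S →+* T) (s : Set (A → S)) :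
    extendScalarsAlong f (Submodule.span S s) =
      Submodule.span T ((fun φ a => f (φ a)) '' s) := by
  apply le_antisymm
  · rw [extendScalarsAlong, Submodule.span_le]
    rintro _ ⟨φ, hφ, rfl⟩
    rw [SetLike.mem_coe] at hφ ⊢
    induction hφ using Submodule.span_induction with
    | mem x hx => exact Submodule.subset_span ⟨x, hx, rfl⟩
    | zero =>
      simp only [Pi.zero_apply, map_zero]
      exact Submodule.zero_mem _
    | add x y _ _ hx hy =>
      simp only [Pi.add_apply, map_add]
      exact Submodule.add_mem _ hx hy
    | smul r x _ hx =>
      simp only [Pi.smul_apply, smul_eq_mul, map_mul]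
      exact Submodule.smul_mem _ (f r) hx
  · exact Submodule.span_mono (Set.image_mono Submodule.subset_span)

theorem span_image_eq_of_units_smul {ι M : Type*} [AddCommGroup M] [Module T M] {s : Set ι}
    {f g : ι → M} (h : ∀ i ∈ s, ∃ c : Tˣ, f i = c • g i) :
    Submodule.span T (f '' s) = Submodule.span T (g '' s) := by
  apply le_antisymm <;> rw [Submodule.span_le] <;> rintro _ ⟨i, hi, rfl⟩ <;>
    obtain ⟨c, hc⟩ := h i hi
  · rw [hc]
    exact Submodule.smul_mem _ (c : T) (Submodule.subset_span ⟨i, hi, rfl⟩)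
  · have : g i = c⁻¹ • f i := by rw [hc, inv_smul_smul]
    rw [this]
    exact Submodule.smul_mem _ ((c⁻¹ : Tˣ) : T) (Submodule.subset_span ⟨i, hi, rfl⟩)

theorem Matrix.map_mulVec_apply {B : Type*} [Fintype A] (f : S →+* T) (P : Matrix B A S)
    (φ : A → S) (b : B) :
    (P.map f).mulVec (fun a => f (φ a)) b = f (P.mulVec φ b) := by
  simp [Matrix.mulVec, dotProduct, map_sum]

end BaseChange

/-! ### Constant families over the affine line and their translates. -/

section ConstantFamilies

variable {A k : Type*} [Field k] [Fintype A]

/-- Expansion in powers of $t$ writes `φ` as a $\mathbf k[t]$-combination of vectors of `U`. -/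
theorem mem_extendScalarsAlong_C_of_coeff {U : Submodule k (A → k)} {φ : A → k[X]}
    (h : ∀ i, (fun a => (φ a).coeff i) ∈ U) : φ ∈ extendScalarsAlong Polynomial.C U := by
  let N := Finset.univ.sup fun a => (φ a).natDegree
  have e : φ = ∑ i ∈ Finset.range (N + 1),
      (Polynomial.X ^ i : k[X]) • fun a => Polynomial.C ((φ a).coeff i) := by
    funext a
    rw [Finset.sum_apply]
    conv_lhs => rw [(φ a).as_sum_range' (N + 1) (Nat.lt_succ_of_le
      (Finset.le_sup (f := fun a => (φ a).natDegree) (Finset.mem_univ a)))]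
    refine Finset.sum_congr rfl fun i _ => ?_
    rw [Pi.smul_apply, smul_eq_mul, mul_comm, Polynomial.C_mul_X_pow_eq_monomial]
  rw [e]
  exact Submodule.sum_mem _ fun i _ => Submodule.smul_mem _ _ (Submodule.subset_span ⟨_, h i, rfl⟩)

/-- A constant family of subspaces is the kernel of a surjection to a free module. -/
theorem exists_surjective_ker_eq_extendScalarsAlong_C (U : Submodule k (A → k)) :
    ∃ F : (A → k[X]) →ₗ[k[X]] (Fin (Fintype.card A - Module.finrank k U) → k[X]),
      Function.Surjective F ∧ LinearMap.ker F = extendScalarsAlong Polynomial.C U := by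
  classical
  set r := Fintype.card A - Module.finrank k U with hr
  have hrank : Module.finrank k ((A → k) ⧸ U) = Module.finrank k (Fin r → k) := by
    have := Submodule.finrank_quotient_add_finrank U
    rw [Module.finrank_fintype_fun_eq_card] at this ⊢
    rw [Fintype.card_fin]
    lia
  let q : (A → k) →ₗ[k] (Fin r → k) := (LinearEquiv.ofFinrankEq _ _ hrank).toLinearMap ∘ₗ U.mkQ
  have hqker : LinearMap.ker q = U := by
    rw [LinearEquiv.ker_comp, Submodule.ker_mkQ]
  have hqsurj : LinearMap.range q = ⊤ := by
    rw [LinearMap.range_eq_top]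
    exact (LinearEquiv.surjective _).comp U.mkQ_surjective
  obtain ⟨s, hs⟩ := LinearMap.exists_rightInverse_of_surjective q hqsurj
  let Q := LinearMap.toMatrix' q
  let S := LinearMap.toMatrix' s
  have hQS : Q * S = 1 := by
    rw [← LinearMap.toMatrix'_comp, hs, LinearMap.toMatrix'_id]
  refine ⟨(Q.map Polynomial.C).mulVecLin, fun y => ⟨(S.map Polynomial.C).mulVec y, ?_⟩, ?_⟩
  · rw [Matrix.mulVecLin_apply, Matrix.mulVec_mulVec, ← Matrix.map_mul, hQS,
      Matrix.map_one _ (map_zero _) (map_one _), Matrix.one_mulVec]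
  · have hQ : ∀ u, Q.mulVec u = q u := fun u => LinearMap.toMatrix'_mulVec q u
    apply le_antisymm
    · intro φ hφ
      refine mem_extendScalarsAlong_C_of_coeff fun i => ?_
      rw [← hqker, LinearMap.mem_ker, ← hQ]
      funext b
      have := congrArg (fun p : k[X] => p.coeff i) (congrFun hφ b)
      simpa [Matrix.mulVec, dotProduct, Polynomial.finsetSum_coeff] using this
    · rw [extendScalarsAlong, Submodule.span_le]
      rintro _ ⟨u, hu, rfl⟩
      rw [SetLike.mem_coe, LinearMap.mem_ker, Matrix.mulVecLin_apply]
      funext b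
      rw [← hqker, SetLike.mem_coe, LinearMap.mem_ker, ← hQ] at hu
      rw [Matrix.map_mulVec_apply, hu]
      simp

/-- Moving a constant family by an automorphism of `k[t]^A` gives a point of the Grassmannian. -/
theorem exists_grassmannian_of_isUnit_det [DecidableEq A] {P : Matrix A A k[X]} (hP : IsUnit P.det)
    (U : Submodule k (A → k)) :
    ∃ M : Module.Grassmannian k[X] (A → k[X]) (Fintype.card A - Module.finrank k U),
      M.toSubmodule = (extendScalarsAlong Polynomial.C U).map P.mulVecLin := by
  obtain ⟨F, hF, hker⟩ := exists_surjective_ker_eq_extendScalarsAlong_C U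
  have hinv : P⁻¹ * P = 1 := Matrix.nonsing_inv_mul P hP
  have hinv' : P * P⁻¹ = 1 := Matrix.mul_nonsing_inv P hP
  let F' := F ∘ₗ P⁻¹.mulVecLin
  have hF' : Function.Surjective F' := by
    refine hF.comp fun y => ⟨P.mulVec y, ?_⟩
    rw [Matrix.mulVecLin_apply, Matrix.mulVec_mulVec, hinv, Matrix.one_mulVec]
  have hker' : LinearMap.ker F' = (extendScalarsAlong Polynomial.C U).map P.mulVecLin := by
    ext φ
    rw [← hker, LinearMap.mem_ker, Submodule.mem_map]
    constructor
    · intro h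
      exact ⟨P⁻¹.mulVec φ, h, by
        rw [Matrix.mulVecLin_apply, Matrix.mulVec_mulVec, hinv', Matrix.one_mulVec]⟩
    · rintro ⟨y, hy, rfl⟩
      simpa [F', Matrix.mulVec_mulVec, hinv] using hy
  let e := F'.quotKerEquivOfSurjective hF'
  refine ⟨⟨LinearMap.ker F', Module.Finite.equiv e.symm, Module.Projective.of_equiv e.symm,
    fun p => ?_⟩, hker'⟩
  rw [Module.rankAtStalk_eq_of_equiv e, Module.rankAtStalk_eq_finrank_of_free]
  simp

end ConstantFamilies

/-! ### The limit of a torus orbit. -/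

section LimitOfOrbit

variable {V A k : Type*} [Field k] [Fintype A] (τ : A → V)

theorem isLimitAtZero_splitSubspace (W : Submodule k (A → k)) (π : OrdPartition V) (d : V → ℤ)
    (hd : π.IsInducedBy d) :
    IsLimitAtZero (Module.finrank k W)
      ((extendScalarsAlong LaurentPolynomial.C W).map (torusAct τ fun v => tPow k (-d v)))
      (splitSubspace τ W π) := by
  classical
  obtain ⟨e, he, rfl⟩ := hd
  obtain ⟨g, hg, hW⟩ := exists_isStrictlyLowering_map_splitSubspace τ W π
  set h : A → Fin π.length := fun a => π.level (τ a)
  -- This is $xgx^{-1}$. The truncation by `toNat` is harmless: wherever `g a b` is nonzero the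
  -- exponent is already nonnegative.
  let P : Matrix A A k[X] := Matrix.of fun a b =>
    Polynomial.X ^ (e (h b) - e (h a)).toNat * Polynomial.C (g a b)
  have hP : IsStrictlyLowering h P := by
    refine ⟨fun a => by simp [P, hg.1 a], fun a b hab hlt => ?_⟩
    simp [P, hg.2 a b hab hlt]
  have hle : ∀ a b, g a b ≠ 0 → e (h a) ≤ e (h b) := by
    intro a b hab
    by_cases h1 : a = b
    · rw [h1]
    · exact (he (not_not.1 fun h2 => hab (hg.2 a b h1 h2))).le
  have hPL : ∀ a b, Polynomial.toLaurent (P a b) =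
      LaurentPolynomial.T (e (h b) - e (h a)) * LaurentPolynomial.C (g a b) := by
    intro a b
    by_cases h0 : g a b = 0
    · simp [P, h0]
    · have := Int.toNat_of_nonneg (sub_nonneg.2 (hle a b h0))
      simp only [P, Matrix.of_apply, map_mul, Polynomial.toLaurent_X_pow, Polynomial.toLaurent_C]
      rw [this]
  have hP0 : P.map (Polynomial.evalRingHom 0) = 1 := by
    ext a b
    rw [Matrix.map_apply, Matrix.one_apply]
    split_ifs with hab
    · simp [hab, hP.1 b]
    · by_cases hlt : h a < h b
      · have : (e (h b) - e (h a)).toNat ≠ 0 := by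
          have := he hlt
          lia
        simp [P, this]
      · rw [hP.2 a b hab hlt, map_zero]
  -- Vectors supported on one level are eigenvectors of the torus element, so a spanning set of them
  -- makes $P$ and $xg$ comparable up to units.
  let s : Set (A → k) := {u | u ∈ splitSubspace τ W π ∧ ∃ n, ∀ a, h a ≠ n → u a = 0}
  have hs : splitSubspace τ W π = Submodule.span k s := by
    apply le_antisymm
    · conv_lhs => rw [splitSubspace_eq_iSup]
      refine iSup_le fun n u hu => Submodule.subset_span ⟨?_, n, ?_⟩
      · rw [splitSubspace_eq_iSup]
        exact Submodule.mem_iSup_of_mem n hu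
      · exact ((mem_map_vanishingOff_below τ).1 hu).1
    · rw [Submodule.span_le]
      exact fun u hu => hu.1
  have hW' : W = Submodule.span k (g.mulVecLin '' s) := by
    rw [← Submodule.map_span, ← hs, hW]
  have hex := exists_grassmannian_of_isUnit_det (P := P)
    (by rw [hP.det_eq_one]; exact isUnit_one) (splitSubspace τ W π)
  rw [finrank_splitSubspace τ W π] at hex
  obtain ⟨M, hM⟩ := hex
  refine ⟨M, ?_, ?_⟩
  · rw [hM, hs, extendScalarsAlong_span, Submodule.map_span, extendScalarsAlong_span, hW',
      extendScalarsAlong_span, Submodule.map_span]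
    simp only [Set.image_image]
    refine span_image_eq_of_units_smul ?_
    rintro u ⟨-, n, hn⟩
    -- On level $n$ the factor $x^{-1}$ is the scalar $t^{d_n}$, so $Pu=t^{d_n}\,x\,g\,u$.
    refine ⟨tPow k (e n), ?_⟩
    funext a
    rw [Units.smul_def]
    simp only [Pi.smul_apply, torusAct, LinearMap.pi_apply, LinearMap.smul_apply,
      LinearMap.proj_apply, smul_eq_mul, tPow, Function.comp_apply, Matrix.mulVecLin_apply,
      Matrix.mulVec, dotProduct, map_sum, map_mul, Finset.mul_sum, hPL, Polynomial.toLaurent_C]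
    refine Finset.sum_congr rfl fun b _ => ?_
    by_cases hb : h b = n
    · rw [hb, sub_eq_add_neg, LaurentPolynomial.T_add]
      ring
    · rw [hn b hb]
      simp
  · rw [hM, hs, extendScalarsAlong_span, Submodule.map_span, extendScalarsAlong_span]
    simp only [Set.image_image]
    have : ∀ u : A → k, (fun a => Polynomial.evalRingHom 0
        (P.mulVecLin (fun a => Polynomial.C (u a)) a)) = u := by
      intro u
      funext a
      rw [Matrix.mulVecLin_apply, ← Matrix.map_mulVec_apply, hP0, Matrix.one_mulVec]
      simp
    simp only [this, Set.image_id']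

end LimitOfOrbit

/-! ### Residue conditions tested on vertex functions, and flows. -/

namespace Multigraph

variable {V A k : Type*} (G : Multigraph V A)

theorem tail_rev (a : A) : G.tail (G.rev a) = G.head a := rfl

theorem head_rev (a : A) : G.head (G.rev a) = G.tail a := by
  rw [head, G.rev_rev]

/-- Functions on the vertices which are constant on the connected components of the subgraph
induced on `S`. -/
def IsLocallyConstantOn (S : Set V) (p : V → k) : Prop :=
  ∀ a, G.tail a ∈ S → G.head a ∈ S → p (G.tail a) = p (G.head a)

variable {G}

theorem IsLocallyConstantOn.eq_of_reachable {S : Set V} {p : V → k}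
    (hp : G.IsLocallyConstantOn S p) {u v : S}
    (h : (G.toSimpleGraph.induce S).Reachable u v) : p u = p v := by
  obtain ⟨w⟩ := h
  induction w with
  | nil => rfl
  | @cons u v _ hadj _ ih =>
    rw [← ih]
    rw [SimpleGraph.comap_adj, toSimpleGraph, SimpleGraph.fromRel_adj] at hadj
    obtain ⟨-, ⟨a, ha, hb⟩ | ⟨a, ha, hb⟩⟩ := hadj
    · have := hp a (by rw [ha]; exact u.2) (by rw [hb]; exact v.2)
      rwa [ha, hb] at this
    · have := hp a (by rw [ha]; exact v.2) (by rw [hb]; exact u.2)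
      rw [ha, hb] at this
      exact this.symm

theorem connectedComponentMk_tail_eq_head {S : Set V} {a : A} (ht : G.tail a ∈ S)
    (hh : G.head a ∈ S) :
    (G.toSimpleGraph.induce S).connectedComponentMk ⟨G.tail a, ht⟩ =
      (G.toSimpleGraph.induce S).connectedComponentMk ⟨G.head a, hh⟩ := by
  rw [SimpleGraph.ConnectedComponent.eq]
  by_cases h : G.tail a = G.head a
  · have : (⟨G.tail a, ht⟩ : S) = ⟨G.head a, hh⟩ := Subtype.ext h
    rw [this]
  · refine SimpleGraph.Adj.reachable ?_
    rw [SimpleGraph.comap_adj, toSimpleGraph, SimpleGraph.fromRel_adj]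
    exact ⟨h, Or.inl ⟨a, rfl, rfl⟩⟩

theorem mem_image_supp {S : Set V}
    {Ξ : (G.toSimpleGraph.induce S).ConnectedComponent} {v : V} (hv : v ∈ S) :
    v ∈ Subtype.val '' Ξ.supp ↔ (G.toSimpleGraph.induce S).connectedComponentMk ⟨v, hv⟩ = Ξ := by
  constructor
  · rintro ⟨x, hx, rfl⟩
    exact hx
  · intro h
    exact ⟨⟨v, hv⟩, h, rfl⟩

variable [Fintype A]

/-- Reversal has no fixed arrow, so the terms cancel in pairs. No division by 2 occurs, and
characteristic 2 is allowed. -/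
theorem sum_eq_zero_of_add_rev_eq_zero [AddCommGroup k] {F : A → k}
    (h : ∀ a, F a + F (G.rev a) = 0) : ∑ a, F a = 0 :=
  Finset.sum_involution (fun a _ => G.rev a) (fun a _ => h a) (fun a _ _ => G.rev_ne a)
    (fun _ _ => Finset.mem_univ _) (fun a _ => G.rev_rev a)

theorem sum_comp_rev [AddCommMonoid k] (F : A → k) : ∑ a, F (G.rev a) = ∑ a, F a :=
  Equiv.sum_comp (Function.Involutive.toPerm G.rev G.rev_rev) F

variable [Field k]

open scoped Classical in
/-- The residue conditions over a level, stated with locally constant functions. -/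
theorem forall_component_sum_eq_zero_iff [Finite V] {π : OrdPartition V} {n : Fin π.length}
    {ψ : A → k} :
    (∀ Ξ : (G.toSimpleGraph.induce (π.strictlyBelow n)).ConnectedComponent,
      ∑ a with G.IsUpward π a ∧ π.level (G.tail a) = n ∧ G.head a ∈ Subtype.val '' Ξ.supp,
        ψ a = 0) ↔
    ∀ p : V → k, G.IsLocallyConstantOn (π.strictlyBelow n) p →
      ∑ a, (if π.level (G.tail a) = n ∧ π.level (G.head a) < n then p (G.head a) * ψ a else 0)
        = 0 := by
  constructor
  · intro h p hp
    have := Fintype.ofFinite (G.toSimpleGraph.induce (π.strictlyBelow n)).ConnectedComponent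
    have hout : ∀ v (hv : v ∈ π.strictlyBelow n),
        p ((G.toSimpleGraph.induce (π.strictlyBelow n)).connectedComponentMk ⟨v, hv⟩).out.1 =
          p v := fun v hv =>
      hp.eq_of_reachable (SimpleGraph.ConnectedComponent.exact (Quot.out_eq _))
    -- On `π.strictlyBelow n`, `p` is the combination of component indicators weighted by its values
    -- at chosen representatives.
    have key : ∀ a,
        (if π.level (G.tail a) = n ∧ π.level (G.head a) < n then p (G.head a) * ψ a else 0) =
        ∑ Ξ : (G.toSimpleGraph.induce (π.strictlyBelow n)).ConnectedComponent, p Ξ.out.1 *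
          (if G.IsUpward π a ∧ π.level (G.tail a) = n ∧ G.head a ∈ Subtype.val '' Ξ.supp
            then ψ a else 0) := by
      intro a
      split_ifs with ha
      · have ha1 := ha.1
        have ha2 : G.head a ∈ π.strictlyBelow n := ha.2
        rw [Finset.sum_eq_single_of_mem
          ((G.toSimpleGraph.induce (π.strictlyBelow n)).connectedComponentMk ⟨G.head a, ha2⟩)
          (Finset.mem_univ _), hout, if_pos]
        · exact ⟨by rw [IsUpward, ha1]; exact ha2, ha1, (mem_image_supp ha2).2 rfl⟩
        · intro Ξ _ hΞ
          rw [if_neg, mul_zero]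
          rintro ⟨-, -, h3⟩
          exact hΞ ((mem_image_supp ha2).1 h3).symm
      · symm
        refine Finset.sum_eq_zero fun Ξ _ => ?_
        rw [if_neg, mul_zero]
        rintro ⟨h1, h2, -⟩
        exact ha ⟨h2, h2 ▸ h1⟩
    simp only [key]
    rw [Finset.sum_comm]
    refine Finset.sum_eq_zero fun Ξ _ => ?_
    rw [← Finset.mul_sum, ← Finset.sum_filter, h Ξ, mul_zero]
  · intro h Ξ
    have hp : G.IsLocallyConstantOn (π.strictlyBelow n)
        (fun v => if v ∈ Subtype.val '' Ξ.supp then (1 : k) else 0) := by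
      intro a ht hh
      simp only [mem_image_supp ht, mem_image_supp hh, connectedComponentMk_tail_eq_head ht hh]
    rw [← h _ hp, Finset.sum_filter]
    refine Finset.sum_congr rfl fun a _ => ?_
    by_cases hmem : G.head a ∈ Subtype.val '' Ξ.supp
    · have hlt : π.level (G.head a) < n := by
        obtain ⟨x, -, hx⟩ := hmem
        rw [← hx]
        exact x.2
      simp only [hmem, hlt, and_true, if_true, one_mul]
      refine if_congr (and_iff_right_of_imp fun h => ?_) rfl rfl
      rw [IsUpward, h]
      exact hlt
    · simp [hmem]

open scoped Classical in
theorem forall_vertex_sum_eq_zero_iff [Finite V] {ψ : A → k} :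
    (∀ v, ∑ a with G.tail a = v, ψ a = 0) ↔ ∀ r : V → k, ∑ a, r (G.tail a) * ψ a = 0 := by
  have := Fintype.ofFinite V
  constructor
  · intro h r
    rw [← Finset.sum_fiberwise Finset.univ G.tail]
    refine Finset.sum_eq_zero fun v _ => ?_
    rw [← mul_zero (r v), ← h v, Finset.mul_sum]
    refine Finset.sum_congr rfl fun a ha => ?_
    rw [(Finset.mem_filter.1 ha).2]
  · intro h v
    rw [← h fun u => if u = v then 1 else 0, Finset.sum_filter]
    simp

open scoped Classical in
/-- Membership in the residue space, tested against functions on the vertices. -/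
theorem mem_residueSpace_iff [Finite V] {π : OrdPartition V} {ψ : A → k} :
    ψ ∈ G.residueSpace π k ↔
      (∀ a, π.level (G.tail a) < π.level (G.head a) → ψ a = 0) ∧
      (∀ r : V → k, ∑ a, r (G.tail a) * ψ a = 0) ∧
      (∀ a, π.level (G.tail a) = π.level (G.head a) → ψ a + ψ (G.rev a) = 0) ∧
      ∀ (n : Fin π.length) (p : V → k), G.IsLocallyConstantOn (π.strictlyBelow n) p →
        ∑ a, (if π.level (G.tail a) = n ∧ π.level (G.head a) < n then p (G.head a) * ψ a else 0)
          = 0 := by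
  rw [← forall_vertex_sum_eq_zero_iff]
  simp only [← forall_component_sum_eq_zero_iff]
  rfl

open scoped Classical in
/-- A flow inside `S` with prescribed divergence exists as soon as the divergence is orthogonal
to the locally constant functions. -/
theorem exists_flow [Finite V] (S : Set V) (b : A → k)
    (hb : ∀ p : V → k, G.IsLocallyConstantOn S p →
      ∑ a, (if G.tail a ∈ S then p (G.tail a) * b a else 0) = 0) :
    ∃ f : A → k, (∀ a, f a + f (G.rev a) = 0) ∧
      (∀ a, ¬ (G.tail a ∈ S ∧ G.head a ∈ S) → f a = 0) ∧
      ∀ r : V → k, ∑ a, (if G.tail a ∈ S then r (G.tail a) * (f a - b a) else 0) = 0 := by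
  have := Fintype.ofFinite V
  -- `E` antisymmetrizes inside `S` and `D` is the divergence at the vertices of `S`. The flow
  -- sought is some `E g` with the same divergence as `b`.
  let E : (A → k) →ₗ[k] (A → k) :=
    { toFun := fun g a => if G.tail a ∈ S ∧ G.head a ∈ S then g a - g (G.rev a) else 0
      map_add' := fun x y => by
        funext a
        simp only [Pi.add_apply]
        split_ifs <;> ring
      map_smul' := fun c x => by
        funext a
        simp only [Pi.smul_apply, smul_eq_mul, RingHom.id_apply]
        split_ifs <;> ring }
  let D : (A → k) →ₗ[k] (V → k) :=
    { toFun := fun g v => ∑ a, if G.tail a = v ∧ v ∈ S then g a else 0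
      map_add' := fun x y => by
        funext v
        simp only [Pi.add_apply, ← Finset.sum_add_distrib]
        refine Finset.sum_congr rfl fun a _ => ?_
        split_ifs <;> ring
      map_smul' := fun c x => by
        funext v
        simp only [Pi.smul_apply, smul_eq_mul, RingHom.id_apply, Finset.mul_sum]
        refine Finset.sum_congr rfl fun a _ => ?_
        split_ifs <;> ring }
  have hD : ∀ (r : V → k) (g : A → k),
      ∑ v, r v * D g v = ∑ a, if G.tail a ∈ S then r (G.tail a) * g a else 0 := by
    intro r g
    simp only [D, LinearMap.coe_mk, AddHom.coe_mk, Finset.mul_sum]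
    rw [Finset.sum_comm]
    refine Finset.sum_congr rfl fun a _ => ?_
    rw [Finset.sum_eq_single_of_mem (G.tail a) (Finset.mem_univ _)]
    · simp
    · intro v _ hv
      simp [hv.symm]
  -- Duality: a functional `p` killing the range of `D ∘ₗ E`, tested on a single arrow inside `S`,
  -- takes equal values at its two ends. So `p` is locally constant, and the hypothesis on `b` makes
  -- it kill `D b` as well.
  have hmem : D b ∈ LinearMap.range (D ∘ₗ E) := by
    by_contra hnot
    obtain ⟨l, hl, hle⟩ := Submodule.exists_le_ker_of_notMem hnot
    apply hl
    obtain ⟨p, hl'⟩ : ∃ p : V → k, ∀ x, l x = ∑ v, p v * x v := by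
      refine ⟨fun v => l (Pi.single v 1), fun x => ?_⟩
      conv_lhs => rw [← Finset.univ_sum_single x]
      rw [map_sum]
      refine Finset.sum_congr rfl fun v _ => ?_
      rw [mul_comm, ← smul_eq_mul, ← map_smul, ← Pi.single_smul, smul_eq_mul, mul_one]
    rw [hl', hD]
    refine hb p fun a ht hh => ?_
    have h0 : l (D (E (Pi.single a 1))) = 0 := hle ⟨_, rfl⟩
    rw [hl', hD] at h0
    have h1 : ∀ x, (if G.tail x ∈ S then p (G.tail x) * E (Pi.single a 1) x else 0) =
        (if x = a then p (G.tail a) else 0) - (if x = G.rev a then p (G.head a) else 0) := by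
      intro x
      have hrev : G.rev x = a ↔ x = G.rev a :=
        ⟨fun h => by rw [← h, G.rev_rev], fun h => by rw [h, G.rev_rev]⟩
      simp only [E, LinearMap.coe_mk, AddHom.coe_mk, Pi.single_apply, hrev]
      by_cases hx : x = a
      · subst hx
        simp [ht, hh, (G.rev_ne x).symm]
      · by_cases hx' : x = G.rev a
        · subst hx'
          simp [ht, hh, tail_rev, head_rev, G.rev_ne a]
        · simp [hx, hx']
    simp only [h1, Finset.sum_sub_distrib, Finset.sum_ite_eq', Finset.mem_univ, if_true] at h0
    exact sub_eq_zero.1 h0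
  obtain ⟨g, hg⟩ := hmem
  refine ⟨E g, fun a => ?_, fun a ha => ?_, fun r => ?_⟩
  · simp only [E, LinearMap.coe_mk, AddHom.coe_mk, tail_rev, head_rev, G.rev_rev]
    by_cases h1 : G.tail a ∈ S <;> by_cases h2 : G.head a ∈ S <;> simp [h1, h2]
  · simp only [E, LinearMap.coe_mk, AddHom.coe_mk, if_neg ha]
  · have : D (E g - b) = 0 := by rw [map_sub, sub_eq_zero]; exact hg
    have h2 := hD r (E g - b)
    rw [this] at h2
    simpa using h2.symm

end Multigraph

/-! ### The residue space as a splitting. -/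

namespace Multigraph

variable {V A k : Type*} {G : Multigraph V A} [Finite V] [Fintype A] [Field k]
  {π π' : OrdPartition V}

theorem splitSubspace_residueSpace_le (hπ : π'.IsCoarsening π) :
    splitSubspace G.tail (G.residueSpace π' k) π ≤ G.residueSpace π k := by
  classical
  obtain ⟨c, hc, hlev⟩ := hπ
  have hl : ∀ v, π'.level v = c (π.level v) := fun v => congrFun hlev v
  intro φ hφ
  rw [mem_splitSubspace] at hφ
  refine mem_residueSpace_iff.2 ⟨fun a ha => ?_, ?_, fun a ha => ?_, fun n p hp => ?_⟩
  · obtain ⟨w, hw, h1, h2⟩ := hφ (π.level (G.tail a))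
    obtain ⟨hdown, -, hhor, -⟩ := mem_residueSpace_iff.1 hw
    rw [← h2 a rfl]
    rcases (hc ha.le).lt_or_eq with h | h
    · exact hdown a (by rwa [hl, hl])
    · have := hhor a (by rwa [hl, hl])
      rwa [h1 (G.rev a) ha, add_zero] at this
  · rw [← forall_vertex_sum_eq_zero_iff]
    intro v
    obtain ⟨w, hw, -, h2⟩ := hφ (π.level v)
    rw [← forall_vertex_sum_eq_zero_iff.2 (mem_residueSpace_iff.1 hw).2.1 v]
    refine Finset.sum_congr rfl fun a ha => (h2 a ?_).symm
    rw [(Finset.mem_filter.1 ha).2]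
  · obtain ⟨w, hw, -, h2⟩ := hφ (π.level (G.tail a))
    rw [← h2 a rfl, ← h2 (G.rev a) ha.symm]
    exact (mem_residueSpace_iff.1 hw).2.2.1 a (by rw [hl, hl, ha])
  · obtain ⟨w, hw, h1, h2⟩ := hφ n
    obtain ⟨hdown, hvert, hhor, hres⟩ := mem_residueSpace_iff.1 hw
    simp only [hl] at hdown hhor hres
    -- Cut off at level `n`, `p` is an admissible test function for `π'`, because every vertex in a
    -- coarse level below `c n` has fine level below `n`.
    let q : V → k := fun v => if π.level v < n then p v else 0
    have hq : G.IsLocallyConstantOn (π'.strictlyBelow (c n)) q := by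
      have hlt : ∀ v ∈ π'.strictlyBelow (c n), π.level v < n := fun v hv =>
        hc.reflect_lt ((hl v).symm.trans_lt hv)
      intro a ht hh
      simp only [q, hlt _ ht, hlt _ hh, if_true]
      exact hp a (hlt _ ht) (hlt _ hh)
    have e1 := hvert fun v => if c (π.level v) = c n then q v else 0
    have e2 := hres (c n) q hq
    -- Integration by parts: fine residue term minus coarse residue term plus vertex term is
    -- antisymmetric under reversal. The coarse term vanishes by `e2` and the vertex term, over the
    -- coarse part of `n`, by `e1`; the fine term remains.
    have e3 : ∑ a, ((if π.level (G.tail a) = n ∧ π.level (G.head a) < n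
          then p (G.head a) * w a else 0) -
        (if c (π.level (G.tail a)) = c n ∧ c (π.level (G.head a)) < c n
          then q (G.head a) * w a else 0) +
        (if c (π.level (G.tail a)) = c n then q (G.tail a) else 0) * w a) = 0 := by
      refine sum_eq_zero_of_add_rev_eq_zero (G := G) fun a => ?_
      have f1 := hdown a
      have f2 := hdown (G.rev a)
      have f3 := hhor a
      have f4 := h1 a
      have f5 := h1 (G.rev a)
      have f6 := hp a
      have m1 := fun h => @hc (π.level (G.tail a)) n h
      have m2 := fun h => @hc n (π.level (G.tail a)) h
      have m3 := fun h => @hc (π.level (G.head a)) n h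
      have m4 := fun h => @hc n (π.level (G.head a)) h
      simp only [tail_rev, head_rev, q] at *
      simp only [OrdPartition.strictlyBelow, Set.mem_ofPred_eq] at f6
      clear e1 e2 hq hdown hvert hhor hres h1 h2 hφ hw hp hl hlev
      grind
    rw [Finset.sum_add_distrib, Finset.sum_sub_distrib, e1, e2, sub_zero, add_zero] at e3
    refine Eq.trans (Finset.sum_congr rfl fun a _ => ?_) e3
    split_ifs with h
    · rw [h2 a h.1]
    · rfl

theorem residueSpace_le_splitSubspace (hπ : π'.IsCoarsening π) :
    G.residueSpace π k ≤ splitSubspace G.tail (G.residueSpace π' k) π := by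
  classical
  obtain ⟨c, hc, hlev⟩ := hπ
  have hl : ∀ v, π'.level v = c (π.level v) := fun v => congrFun hlev v
  intro ψ hψ
  obtain ⟨hdown, hvert, hhor, hres⟩ := mem_residueSpace_iff.1 hψ
  rw [mem_splitSubspace]
  intro n
  -- The prescribed divergence at a vertex below `n` is the total of `ψ` on the arrows entering it
  -- from level `n`. Its orthogonality to locally constant functions is the residue condition on
  -- `ψ`.
  obtain ⟨f, hanti, hsupp, hdiv⟩ := exists_flow (G := G) (π.strictlyBelow n)
    (fun a => if π.level (G.head a) = n then ψ (G.rev a) else 0) (by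
      intro p hp
      rw [← sum_comp_rev (G := G)]
      refine Eq.trans (Finset.sum_congr rfl fun a _ => ?_) (hres n p hp)
      simp only [tail_rev, head_rev, G.rev_rev, OrdPartition.strictlyBelow, Set.mem_ofPred_eq]
      by_cases h1 : π.level (G.tail a) = n <;> by_cases h2 : π.level (G.head a) < n <;>
        simp [h1, h2])
  simp only [OrdPartition.strictlyBelow, Set.mem_ofPred_eq] at hsupp
  replace hdiv : ∀ r : V → k, ∑ a, (if π.level (G.tail a) < n then r (G.tail a) *
      (f a - if π.level (G.head a) = n then ψ (G.rev a) else 0) else 0) = 0 :=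
    fun r => by
      convert hdiv r
      exact Iff.rfl
  -- Level `n` keeps `ψ`. Below it, inside the same coarse part, arrows into level `n` get minus the
  -- value on the reverse arrow, since they are horizontal for `π'`, and the flow restores the
  -- vertex sums. Lower coarse parts get 0.
  let w : A → k := fun a =>
    if π.level (G.tail a) = n then ψ a
    else if π.level (G.tail a) < n ∧ c (π.level (G.tail a)) = c n then
      f a - (if π.level (G.head a) = n then ψ (G.rev a) else 0)
    else 0
  have hw1 : ∀ a, π.level (G.tail a) = n → w a = ψ a := fun a ha => if_pos ha
  have hw2 : ∀ a, n < π.level (G.tail a) → w a = 0 := fun a ha => by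
    simp only [w, if_neg ha.ne', ha.not_gt, false_and, if_false]
  have hw3 : ∀ a, π.level (G.tail a) < n → c (π.level (G.tail a)) = c n →
      w a = f a - (if π.level (G.head a) = n then ψ (G.rev a) else 0) := fun a ha ha' => by
    simp only [w, if_neg ha.ne, ha, ha', true_and, if_true]
  have hw4 : ∀ a, c (π.level (G.tail a)) ≠ c n → w a = 0 := fun a ha => by
    have : π.level (G.tail a) ≠ n := fun h => ha (congrArg c h)
    simp only [w, if_neg this, ha, and_false, if_false]
  refine ⟨w, mem_residueSpace_iff.2 ⟨fun a ha => ?_, fun r => ?_, fun a ha => ?_,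
    fun m p hp => ?_⟩, hw2, hw1⟩
  · rw [hl, hl] at ha
    have hlt := hc.reflect_lt ha
    by_cases hn : c (π.level (G.tail a)) = c n
    · have hgt : n < π.level (G.head a) := hc.reflect_lt (hn ▸ ha)
      rcases lt_trichotomy (π.level (G.tail a)) n with h | h | h
      · rw [hw3 a h hn, hsupp a fun h' => h'.2.not_gt hgt, if_neg hgt.ne', sub_zero]
      · rw [hw1 a h, hdown a hlt]
      · exact hw2 a h
    · exact hw4 a hn
  · have e1 := hvert fun v => if π.level v = n then r v else 0
    have e2 := hdiv fun v => if c (π.level v) = c n then r v else 0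
    have e3 := congrArg₂ (· + ·) e1 e2
    simp only [← Finset.sum_add_distrib, add_zero] at e3
    refine Eq.trans (Finset.sum_congr rfl fun a _ => ?_) e3
    rcases lt_trichotomy (π.level (G.tail a)) n with h | h | h
    · by_cases hn : c (π.level (G.tail a)) = c n
      · simp [hw3 a h hn, h, h.ne, hn]
      · simp [hw4 a hn, h.ne, hn]
    · simp [hw1 a h, h]
    · simp [hw2 a h, h.not_gt, h.ne']
  · rw [hl, hl] at ha
    have m1 := fun h => @hc n (π.level (G.tail a)) h
    have m2 := fun h => @hc n (π.level (G.head a)) h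
    have f1 := hw1 a
    have f2 := hw2 a
    have f3 := hw3 a
    have f4 := hw4 a
    have g1 := hw1 (G.rev a)
    have g2 := hw2 (G.rev a)
    have g3 := hw3 (G.rev a)
    have g4 := hw4 (G.rev a)
    have i1 := hanti a
    have i2 := hsupp a
    have i3 := hsupp (G.rev a)
    have i4 := hdown a
    have i5 := hdown (G.rev a)
    have i6 := hhor a
    simp only [tail_rev, head_rev, G.rev_rev] at *
    clear_value w
    clear hw1 hw2 hw3 hw4 hanti hsupp hdown hhor hvert hres hdiv hl hlev hψ
    grind
  · simp only [hl]
    by_cases hm : m = c n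
    · subst hm
      have e1 := hdiv fun v => if c (π.level v) < c n then p v else 0
      -- What `w` sends into the lower coarse parts is cancelled, arrow against reverse, by the
      -- divergence identity of `f` weighted by `p` there; flow between vertices of those parts
      -- cancels because `p` is locally constant.
      have e3 : ∑ a, ((if c (π.level (G.tail a)) = c n ∧ c (π.level (G.head a)) < c n
            then p (G.head a) * w a else 0) +
          (if π.level (G.tail a) < n then (if c (π.level (G.tail a)) < c n
            then p (G.tail a) else 0) *
            (f a - if π.level (G.head a) = n then ψ (G.rev a) else 0) else 0)) = 0 := by
        refine sum_eq_zero_of_add_rev_eq_zero (G := G) fun a => ?_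
        have f1 := hw1 a
        have f2 := hw2 a
        have f3 := hw3 a
        have g1 := hw1 (G.rev a)
        have g2 := hw2 (G.rev a)
        have g3 := hw3 (G.rev a)
        have i1 := hanti a
        have i2 := hsupp a
        have i3 := hsupp (G.rev a)
        have j1 := hp a
        have m1 := fun h => @hc (π.level (G.tail a)) n h
        have m2 := fun h => @hc (π.level (G.head a)) n h
        have j2 : c (π.level (G.tail a)) < c n → π.level (G.tail a) < n := hc.reflect_lt
        have j3 : c (π.level (G.head a)) < c n → π.level (G.head a) < n := hc.reflect_lt
        simp only [tail_rev, head_rev, G.rev_rev, OrdPartition.strictlyBelow, Set.mem_ofPred_eq,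
          hl] at *
        clear_value w
        clear hw1 hw2 hw3 hw4 hanti hsupp hdown hhor hvert hres hdiv hlev hψ e1 hp
        grind
      rwa [Finset.sum_add_distrib, e1, add_zero] at e3
    · refine Finset.sum_eq_zero fun a _ => ?_
      split_ifs with h
      · rw [hw4 a (h.1 ▸ hm), mul_zero]
      · rfl

/-- The residue space of a level graph is the splitting of the residue space of a coarsening. -/
theorem residueSpace_eq_splitSubspace (hπ : π'.IsCoarsening π) :
    G.residueSpace π k = splitSubspace G.tail (G.residueSpace π' k) π :=
  le_antisymm (residueSpace_le_splitSubspace hπ) (splitSubspace_residueSpace_le hπ)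

end Multigraph

end

theorem theorem5p1 {V A k : Type*} [Fintype V] [Fintype A] [Field k] (G : Multigraph V A)
    (π π' : OrdPartition V) (hπ : π'.IsCoarsening π) (d : V → ℤ) (hd : π.IsInducedBy d) :
    IsLimitAtZero (Module.finrank k (G.residueSpace π' k))
      ((extendScalarsAlong LaurentPolynomial.C (G.residueSpace π' k)).map
        (torusAct G.tail fun v => tPow k (-d v)))
      (G.residueSpace π k) ∧
    G.residueSpace π k = splitSubspace G.tail (G.residueSpace π' k) π ∧
    G.gammaFun π k = subSplitting π (G.gammaFun π' k) ∧
    ∀ I : Set V, G.gammaFun π k I ≤ G.gammaFun π' k I := by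
  have h := Multigraph.residueSpace_eq_splitSubspace (G := G) (k := k) hπ
  refine ⟨?_, h, ?_, fun I => ?_⟩
  · rw [h]
    exact isLimitAtZero_splitSubspace G.tail _ π d hd
  · rw [Multigraph.gammaFun, h]
    exact dimFun_splitSubspace G.tail _ π
  · rw [Multigraph.gammaFun, h]
    exact dimFun_splitSubspace_le G.tail _ π I
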